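/- Let $K$ be an algebraically closed field of characteristic $0$, let $n \ge 2$, and let $f \in K[x_0,\dots,x_n]$ be a homogeneous polynomial of degree $3$ such that the cubic hypersurface $V(f) \subseteq \mathbb{P}^n$ is smooth, i.e. there is no $[v]\in\mathbb{P}^n$ with $f(v)=0$ and $\frac{\partial f}{\partial x_i}(v)=0$ for all $i$. Let $H_f = \left(\frac{\partial^2 f}{\partial x_i \partial x_j}\right)_{0\le i,j\le n}$ be the Hessian matrix of $f$, let $h_f=\det H_f$, and let $\mathcal{H}_f = V(h_f) \subseteq \mathbb{P}^n$ be the closed subscheme defined by $h_f$. Then $h_f \neq 0$, the Hessian hypersurface $\mathcal{H}_f$ is reduced, and its singular locus $$\mathrm{Sing}(\mathcal{H}_f)=\left\{[v]\in\mathbb{P}^n \;\middle|\; h_f(v)=0,\ \frac{\partial h_f}{\partial x_i}(v)=0 \text{ for } i=0,\dots,n\right\}$$ is exactly $$\mathcal{D}_{n-1}(f)=\{[v]\in\mathbb{P}^n \mid \operatorname{rank} H_f(v)\le n-1\}.$$ -/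

import Mathlib

open scoped LinearAlgebra.Projectivization

namespace CubicHessian

noncomputable section

/-- The gradient `∇(g)(v) = (∂g/∂x₀ (v), …, ∂g/∂xₙ (v))`. -/
def gradientAt {K : Type*} [Field K] {n : ℕ}
    (g : MvPolynomial (Fin (n + 1)) K) (v : Fin (n + 1) → K) : Fin (n + 1) → K :=
  fun i => MvPolynomial.eval v (MvPolynomial.pderiv i g)

/-- The set of singular points of the projective hypersurface `V(g) ⊆ ℙⁿ` of a form `g`: the points
`[v]` of `V(g)` at which every partial derivative of `g` vanishes. For homogeneous `g` the
conditions do not depend on the representative `v`, see `mk_mem_singularLocus`. -/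
def singularLocus {K : Type*} [Field K] {n : ℕ}
    (g : MvPolynomial (Fin (n + 1)) K) : Set (ℙ K (Fin (n + 1) → K)) :=
  {p | MvPolynomial.eval p.rep g = 0 ∧ gradientAt g p.rep = 0}

/-- The hypersurface `V(g)` is smooth: it has no singular point. (For `g = 0` every point is
singular, so this forces `g ≠ 0`.) -/
def IsSmoothHypersurface {K : Type*} [Field K] {n : ℕ}
    (g : MvPolynomial (Fin (n + 1)) K) : Prop :=
  singularLocus g = ∅

/-- The equation of `V(g)` in the affine chart `{xᵢ ≠ 0} ≅ 𝔸ⁿ`: set `xᵢ = 1`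
and rename the other variables, in order, to the coordinates of `𝔸ⁿ`. -/
def dehomogenize {K : Type*} [Field K] {n : ℕ} (i : Fin (n + 1))
    (g : MvPolynomial (Fin (n + 1)) K) : MvPolynomial (Fin n) K :=
  MvPolynomial.aeval
    (i.insertNth (1 : MvPolynomial (Fin n) K) MvPolynomial.X :
      Fin (n + 1) → MvPolynomial (Fin n) K) g

/-- The closed subscheme `V(g) ⊆ ℙⁿ` is reduced: it is covered by the affine schemes
`Spec (K[y₁, …, yₙ] / (gᵢ))`, where `gᵢ` is the equation in the chart `{xᵢ ≠ 0}`, and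
all these coordinate rings are reduced. -/
def IsReducedHypersurface {K : Type*} [Field K] {n : ℕ}
    (g : MvPolynomial (Fin (n + 1)) K) : Prop :=
  ∀ i : Fin (n + 1), IsReduced (MvPolynomial (Fin n) K ⧸ Ideal.span {dehomogenize i g})

/-- The Hessian matrix `H_f = (∂²f/∂xᵢ∂xⱼ)`, a matrix of polynomials. -/
def hessianMatrix {K : Type*} [Field K] {n : ℕ}
    (f : MvPolynomial (Fin (n + 1)) K) :
    Matrix (Fin (n + 1)) (Fin (n + 1)) (MvPolynomial (Fin (n + 1)) K) :=
  Matrix.of fun i j => MvPolynomial.pderiv i (MvPolynomial.pderiv j f)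

/-- The Hessian polynomial `h_f = det H_f`, the equation of the Hessian hypersurface. -/
def hessian {K : Type*} [Field K] {n : ℕ}
    (f : MvPolynomial (Fin (n + 1)) K) : MvPolynomial (Fin (n + 1)) K :=
  (hessianMatrix f).det

/-- The Hessian matrix `H_f(v)` evaluated at a vector `v`. -/
def hessianMatrixAt {K : Type*} [Field K] {n : ℕ}
    (f : MvPolynomial (Fin (n + 1)) K) (v : Fin (n + 1) → K) :
    Matrix (Fin (n + 1)) (Fin (n + 1)) K :=
  (hessianMatrix f).map (MvPolynomial.eval v)

/-- The locus `D_k(f) = {[v] ∈ ℙⁿ | rank H_f(v) ≤ k}`. For homogeneous `f` the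
condition does not depend on the representative `v`, see `mk_mem_degeneracyLocus`. -/
def degeneracyLocus {K : Type*} [Field K] {n : ℕ}
    (f : MvPolynomial (Fin (n + 1)) K) (k : ℕ) : Set (ℙ K (Fin (n + 1) → K)) :=
  {p | (hessianMatrixAt f p.rep).rank ≤ k}

theorem eval_smul_of_isHomogeneous {K : Type*} [Field K] {n d : ℕ}
    {g : MvPolynomial (Fin (n + 1)) K} (hg : g.IsHomogeneous d) (a : K) (v : Fin (n + 1) → K) :
    MvPolynomial.eval (a • v) g = a ^ d * MvPolynomial.eval v g := by
  rw [MvPolynomial.eval_eq, MvPolynomial.eval_eq, Finset.mul_sum]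
  refine Finset.sum_congr rfl fun m hm => ?_
  have hd : ∑ i ∈ m.support, m i = d := by
    have h := hg (MvPolynomial.mem_support_iff.1 hm)
    rwa [Finsupp.weight_apply, Finsupp.sum, Finset.sum_congr rfl (fun i _ => by
      rw [Pi.one_apply, smul_eq_mul, mul_one])] at h
  simp only [Pi.smul_apply, smul_eq_mul, mul_pow, Finset.prod_mul_distrib, Finset.prod_pow_eq_pow_sum,
    hd]
  ring

theorem mk_mem_singularLocus {K : Type*} [Field K] {n d : ℕ}
    {g : MvPolynomial (Fin (n + 1)) K} (hg : g.IsHomogeneous d)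
    (v : Fin (n + 1) → K) (hv : v ≠ 0) :
    Projectivization.mk K v hv ∈ singularLocus g ↔
      MvPolynomial.eval v g = 0 ∧ gradientAt g v = 0 := by
  obtain ⟨a, ha⟩ := Projectivization.exists_smul_eq_mk_rep K v hv
  have ha' : (a : K) • v = (Projectivization.mk K v hv).rep := ha
  simp only [singularLocus, Set.mem_ofPred_eq, ← ha', gradientAt, funext_iff, Pi.zero_apply,
    eval_smul_of_isHomogeneous hg, eval_smul_of_isHomogeneous hg.pderiv, mul_eq_zero,
    pow_eq_zero_iff', a.ne_zero, false_and, false_or]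

theorem mk_mem_degeneracyLocus {K : Type*} [Field K] {n d : ℕ}
    {f : MvPolynomial (Fin (n + 1)) K} (hf : f.IsHomogeneous d) (k : ℕ)
    (v : Fin (n + 1) → K) (hv : v ≠ 0) :
    Projectivization.mk K v hv ∈ degeneracyLocus f k ↔ (hessianMatrixAt f v).rank ≤ k := by
  obtain ⟨a, ha⟩ := Projectivization.exists_smul_eq_mk_rep K v hv
  have ha' : (a : K) • v = (Projectivization.mk K v hv).rep := ha
  have h : hessianMatrixAt f (Projectivization.mk K v hv).rep
      = (a : K) ^ (d - 1 - 1) • hessianMatrixAt f v := by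
    ext i j
    simp only [hessianMatrixAt, hessianMatrix, Matrix.map_apply, Matrix.of_apply,
      Matrix.smul_apply, smul_eq_mul, ← ha', eval_smul_of_isHomogeneous hf.pderiv.pderiv]
  have hu : IsUnit ((a : K) ^ (d - 1 - 1)) := a.isUnit.pow _
  rw [degeneracyLocus, Set.mem_ofPred_eq, h, Matrix.rank_smul_of_mem_nonZeroDivisors _ hu.mem_nonZeroDivisors]

end

end CubicHessian

/-! The gradient map `∇f` is quadratic and, by smoothness and Euler's formula, has no nontrivial
zero. Two consequences carry the proof.

Singular locus: suppose `h_f` and its gradient vanish at `v` but the adjugate of `H_f(v)` does not.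
Being symmetric of rank one, it is `γ u uᵀ`, and Jacobi's formula gives `∂ₖh_f(v) = 2γ ∂ₖf(u)`, so
`∇f(u) = 0` with `u ≠ 0`, a contradiction (`adjugate_hessianMatrix_eq_zero`). The adjugate vanishes
exactly when the kernel has dimension at least 2. This works over any extension field, hence also at
generic points.

Nonvanishing and reducedness: a homogeneous map without nontrivial zeros is finite, so in
characteristic 0 no nonzero vector field is killed by its differential
(`derivation_add_smul_eq_zero`). If `h_f = 0`, a kernel vector of `H_f` at the generic point of the
whole space is such a field. If `p²` divides `h_f` in a chart, the kernel at the generic point of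
`V(p)` has dimension at least 2, so it contains a nonzero vector tangent to `V(p)`, again such a
field up to a multiple of the position vector. -/

namespace CubicHessian

noncomputable section

open Module

/-! ### Adjugates and kernels of corank at least 2. -/

section LinearAlgebra

variable {L V m : Type*} [Field L] [AddCommGroup V] [Module L V]

theorem exists_mem_ne_zero_of_two_le_finrank {W : Submodule L V} (hW : 2 ≤ finrank L W)
    (φ : V →ₗ[L] L) : ∃ u ∈ W, u ≠ 0 ∧ φ u = 0 := by
  have : FiniteDimensional L W := FiniteDimensional.of_finrank_pos (by omega)
  have h : LinearMap.ker (φ.domRestrict W) ≠ ⊥ :=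
    LinearMap.ker_ne_bot_of_finrank_lt (by rw [finrank_self]; omega)
  obtain ⟨u, hu, hu0⟩ := (Submodule.ne_bot_iff _).1 h
  exact ⟨u, u.2, by simpa using hu0, by simpa using hu⟩

theorem exists_eq_smul_of_finrank_le_one {W : Submodule L V} [FiniteDimensional L W]
    (hW : finrank L W ≤ 1) {u w : V} (hu : u ∈ W) (hu0 : u ≠ 0) (hw : w ∈ W) :
    ∃ c : L, w = c • u := by
  obtain ⟨x, hx⟩ := finrank_le_one_iff.1 hW
  obtain ⟨a, ha⟩ := hx ⟨u, hu⟩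
  obtain ⟨b, hb⟩ := hx ⟨w, hw⟩
  replace ha : a • (x : V) = u := congrArg Subtype.val ha
  replace hb : b • (x : V) = w := congrArg Subtype.val hb
  have ha0 : a ≠ 0 := by
    rintro rfl
    exact hu0 (by rw [← ha, zero_smul])
  exact ⟨b / a, by rw [← ha, smul_smul, div_mul_cancel₀ _ ha0, hb]⟩

variable [Fintype m] [DecidableEq m]

theorem updateRow_mulVec (M : Matrix m m L) (j : m) (b w : m → L) (k : m) :
    (M.updateRow j b).mulVec w k = if k = j then b ⬝ᵥ w else M.mulVec w k := by
  by_cases h : k = j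
  · subst h
    simp [Matrix.mulVec]
  · simp [Matrix.mulVec, h]

/-- Entry `(i, j)` is the determinant of `M` with row `j` replaced by `eᵢ`; a kernel vector with
zero `i`-th coordinate makes it singular. -/
theorem adjugate_eq_zero_of_two_le_finrank_ker {M : Matrix m m L}
    (h : 2 ≤ finrank L (LinearMap.ker M.mulVecLin)) : M.adjugate = 0 := by
  ext i j
  rw [Matrix.adjugate_apply, Matrix.zero_apply, ← Matrix.exists_mulVec_eq_zero_iff]
  obtain ⟨u, hu, hu0, hui⟩ := exists_mem_ne_zero_of_two_le_finrank h (LinearMap.proj i)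
  refine ⟨u, hu0, funext fun k => ?_⟩
  rw [LinearMap.mem_ker, Matrix.mulVecLin_apply] at hu
  rw [updateRow_mulVec, hu]
  simpa using fun _ => hui

/-- If the kernel were a line through `u` with `uᵢ ≠ 0`, take `eⱼ` outside the range. Vanishing of
entry `(i, j)` yields `w ≠ 0` with `wᵢ = 0` and `M w` a multiple of `eⱼ`; that multiple is zero, so
`w` lies on the line, and `wᵢ = 0` forces `w = 0`. -/
theorem two_le_finrank_ker_of_adjugate_eq_zero [Nonempty m] {M : Matrix m m L}
    (h : M.adjugate = 0) : 2 ≤ finrank L (LinearMap.ker M.mulVecLin) := by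
  by_contra! hlt
  have hdet : M.det = 0 := by
    have h1 := M.mul_adjugate
    rw [h, mul_zero] at h1
    obtain ⟨i⟩ := ‹Nonempty m›
    simpa using (congrFun (congrFun h1 i) i).symm
  obtain ⟨u, hu0, hu⟩ := Matrix.exists_mulVec_eq_zero_iff.2 hdet
  obtain ⟨i, hi⟩ := Function.ne_iff.1 hu0
  obtain ⟨j, hj⟩ : ∃ j, ∀ w, M.mulVec w ≠ Pi.single j 1 := by
    by_contra! hall
    have hsurj : Function.Surjective M.mulVecLin := by
      rw [← LinearMap.range_eq_top, eq_top_iff, ← (Pi.basisFun L m).span_eq, Submodule.span_le]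
      rintro _ ⟨j, rfl⟩
      obtain ⟨w, hw⟩ := hall j
      exact ⟨w, by simpa using hw⟩
    exact hu0 (LinearMap.injective_iff_surjective.2 hsurj (by simpa using hu))
  have hdet' : (M.updateRow j (Pi.single i 1)).det = 0 := by
    rw [← Matrix.adjugate_apply, h, Matrix.zero_apply]
  obtain ⟨w, hw0, hw⟩ := Matrix.exists_mulVec_eq_zero_iff.2 hdet'
  have hw' : ∀ k, (if k = j then w i else M.mulVec w k) = 0 := fun k => by
    have := congrFun hw k
    rwa [updateRow_mulVec, single_dotProduct, one_mul] at this
  have hwi : w i = 0 := by simpa using hw' j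
  have hwM : M.mulVec w = Pi.single j (M.mulVec w j) := by
    ext k
    by_cases hk : k = j
    · subst hk
      simp
    · simpa [hk] using hw' k
  by_cases hc : M.mulVec w j = 0
  · obtain ⟨c, rfl⟩ := exists_eq_smul_of_finrank_le_one (W := LinearMap.ker M.mulVecLin)
      (by omega) (u := u) (w := w) (by simpa using hu) hu0 (by simpa [hc] using hwM)
    rcases mul_eq_zero.1 (by simpa using hwi : c * u i = 0) with rfl | h0
    · simp at hw0
    · exact hi h0
  · refine hj ((M.mulVec w j)⁻¹ • w) ?_
    rw [Matrix.mulVec_smul, hwM]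
    ext k
    by_cases hk : k = j
    · subst hk
      simp [hc]
    · simp [hk]

/-- All columns of the adjugate lie in the kernel line, so they are multiples of one nonzero column
`u`; symmetry makes its diagonal entry nonzero, and `γ` is the inverse of that entry. -/
theorem exists_adjugate_apply_eq [Nonempty m] {M : Matrix m m L} (hM : M.IsSymm)
    (hdet : M.det = 0) (hadj : M.adjugate ≠ 0) :
    ∃ u : m → L, u ≠ 0 ∧ ∃ γ : L, γ ≠ 0 ∧ ∀ i j, M.adjugate i j = γ * (u i * u j) := by
  have hker : finrank L (LinearMap.ker M.mulVecLin) ≤ 1 := by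
    by_contra! h
    exact hadj (adjugate_eq_zero_of_two_le_finrank_ker h)
  have hcol : ∀ j, M.mulVec (fun i => M.adjugate i j) = 0 := fun j => by
    have h := M.mul_adjugate
    rw [hdet, zero_smul] at h
    ext i
    exact congrFun (congrFun h i) j
  have hsymm : ∀ i j, M.adjugate i j = M.adjugate j i := fun i j => hM.adjugate.apply j i
  obtain ⟨j₀, h₀⟩ : ∃ j, (fun i => M.adjugate i j) ≠ 0 := by
    by_contra! h
    exact hadj (Matrix.ext fun i j => congrFun (h j) i)
  have hc : ∀ j, ∃ c : L, (fun i => M.adjugate i j) = c • fun i => M.adjugate i j₀ := fun j =>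
    exists_eq_smul_of_finrank_le_one hker (by simpa using hcol j₀) h₀ (by simpa using hcol j)
  choose c hc using hc
  have hc' : ∀ i j, M.adjugate i j = c j * M.adjugate i j₀ := fun i j => congrFun (hc j) i
  have hd : M.adjugate j₀ j₀ ≠ 0 := fun h => h₀ (funext fun i => by
    rw [hsymm, hc' j₀ i, h, mul_zero, Pi.zero_apply])
  refine ⟨_, h₀, (M.adjugate j₀ j₀)⁻¹, inv_ne_zero hd, fun i j => ?_⟩
  rw [hc' i j, hsymm j j₀, hc' j₀ j]
  field_simp

end LinearAlgebra

/-! ### Jacobi's formula and the chain rule. -/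

section Derivation

theorem derivation_prod {R A ι : Type*} [CommRing R] [CommRing A] [Algebra R A] [DecidableEq ι]
    (D : Derivation R A A) (s : Finset ι) (a : ι → A) :
    D (∏ i ∈ s, a i) = ∑ k ∈ s, (∏ i ∈ s.erase k, a i) * D (a k) := by
  induction s using Finset.induction_on with
  | empty => simp
  | insert x s hx ih =>
    rw [Finset.prod_insert hx, D.leibniz, ih, Finset.sum_insert hx, Finset.erase_insert hx,
      add_comm, smul_eq_mul, smul_eq_mul, Finset.mul_sum]
    refine congrArg _ (Finset.sum_congr rfl fun k hk => ?_)
    have hxk : x ≠ k := fun h => hx (h ▸ hk)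
    rw [Finset.erase_insert_of_ne hxk, Finset.prod_insert (by simp [hx]), mul_assoc]

/-- Jacobi's formula. -/
theorem derivation_det {R A m : Type*} [CommRing R] [CommRing A] [Algebra R A] [Fintype m]
    [DecidableEq m] (D : Derivation R A A) (M : Matrix m m A) :
    D M.det = ∑ j, ∑ i, M.adjugate j i * D (M i j) := by
  have h : D M.det = ∑ j, (M.updateCol j fun i => D (M i j)).det := by
    simp only [Matrix.det_apply', map_sum]
    conv_rhs => rw [Finset.sum_comm]
    refine Finset.sum_congr rfl fun σ _ => ?_
    rw [← Finset.mul_sum, D.leibniz, D.map_intCast, smul_zero, add_zero, smul_eq_mul,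
      derivation_prod]
    refine congrArg _ (Finset.sum_congr rfl fun k _ => ?_)
    rw [← Finset.mul_prod_erase Finset.univ _ (Finset.mem_univ k), Matrix.updateCol_self, mul_comm]
    refine congrArg _ (Finset.prod_congr rfl fun i hi => ?_)
    rw [Matrix.updateCol_ne (Finset.ne_of_mem_erase hi)]
  rw [h]
  refine Finset.sum_congr rfl fun j _ => ?_
  rw [← Matrix.cramer_apply, Matrix.cramer_eq_adjugate_mulVec]
  rfl

theorem derivation_aeval {K A B σ : Type*} [CommRing K] [CommRing A] [CommRing B] [Algebra K A]
    [Algebra K B] [Algebra A B] [IsScalarTower K A B] [Fintype σ] (D : Derivation K A B)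
    (v : σ → A) (g : MvPolynomial σ K) :
    D (MvPolynomial.aeval v g) =
      ∑ j, MvPolynomial.aeval v (MvPolynomial.pderiv j g) • D (v j) := by
  classical
  induction g using MvPolynomial.induction_on with
  | C a => simp
  | add p q hp hq => simp [hp, hq, add_smul, Finset.sum_add_distrib]
  | mul_X p i hp =>
    simp [hp, add_smul, Finset.sum_add_distrib, MvPolynomial.pderiv_X, Pi.single_apply, mul_smul,
      Finset.smul_sum, apply_ite]

end Derivation

/-! ### Finiteness of homogeneous maps without nontrivial zeros. -/

section FiniteMap

open MvPolynomial

attribute [local instance] MvPolynomial.gradedAlgebra in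
theorem homogeneousComponent_mul_of_isHomogeneous {K σ : Type*} [Field K] {p q : MvPolynomial σ K} {e d : ℕ}
    (hq : q.IsHomogeneous e) (h : e ≤ d) :
    homogeneousComponent d (p * q) = homogeneousComponent (d - e) p * q := by
  have := DirectSum.coe_decompose_mul_of_right_mem_of_le (homogeneousSubmodule σ K) (a := p)
    (b := q) (n := d) ((mem_homogeneousSubmodule e q).2 hq) h
  simpa only [DirectSum.decompose, Equiv.coe_fn_mk, decomposition.decompose'_apply] using this

variable {K σ : Type*} [Field K] [Fintype σ]

theorem exists_pow_X_mem_span [IsAlgClosed K] {F : σ → MvPolynomial σ K}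
    (hF : ∀ v : σ → K, (∀ i, eval v (F i) = 0) → v = 0) :
    ∃ N₀, ∀ N, N₀ ≤ N → ∀ k, (X k ^ N : MvPolynomial σ K) ∈ Ideal.span (Set.range F) := by
  have h : ∀ k, ∃ N, (X k ^ N : MvPolynomial σ K) ∈ Ideal.span (Set.range F) := fun k => by
    change X k ∈ (Ideal.span (Set.range F)).radical
    rw [← vanishingIdeal_zeroLocus_eq_radical (K := K), mem_vanishingIdeal_iff]
    intro v hv
    have hv0 : v = 0 := hF v fun i => hv _ (Ideal.subset_span ⟨i, rfl⟩)
    simp [hv0]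
  choose N hN using h
  exact ⟨∑ k, N k, fun M hM k => Ideal.pow_mem_of_pow_mem _ (hN k)
    ((Finset.single_le_sum (fun _ _ => Nat.zero_le _) (Finset.mem_univ k)).trans hM)⟩

/-- By the Nullstellensatz powers of the variables lie in `(F)`, a fact that survives in every
extension field. -/
theorem eq_zero_of_aeval_eq_zero [IsAlgClosed K] {F : σ → MvPolynomial σ K}
    (hF : ∀ v : σ → K, (∀ i, eval v (F i) = 0) → v = 0) {L : Type*} [Field L] [Algebra K L]
    {v : σ → L} (hv : ∀ i, aeval v (F i) = 0) : v = 0 := by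
  obtain ⟨N, hN⟩ := exists_pow_X_mem_span hF
  have hle : Ideal.span (Set.range F) ≤ RingHom.ker (aeval v : MvPolynomial σ K →ₐ[K] L) := by
    rw [Ideal.span_le]
    rintro _ ⟨i, rfl⟩
    exact hv i
  ext k
  have := hle (hN N le_rfl k)
  rw [RingHom.mem_ker, map_pow, aeval_X] at this
  exact eq_zero_of_pow_eq_zero this

theorem exists_pow_X_eq_sum [IsAlgClosed K] {F : σ → MvPolynomial σ K} {e : ℕ}
    (hF : ∀ v : σ → K, (∀ i, eval v (F i) = 0) → v = 0) (he : ∀ i, (F i).IsHomogeneous e) :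
    ∃ N, e ≤ N ∧ ∀ k, ∃ c : σ → MvPolynomial σ K, (∀ i, (c i).IsHomogeneous (N - e)) ∧
      X k ^ N = ∑ i, c i * F i := by
  obtain ⟨N₀, hN₀⟩ := exists_pow_X_mem_span hF
  refine ⟨N₀ + e, by omega, fun k => ?_⟩
  obtain ⟨c, hc⟩ := Ideal.mem_span_range_iff_exists_fun.1 (hN₀ (N₀ + e) (by omega) k)
  refine ⟨fun i => homogeneousComponent (N₀ + e - e) (c i),
    fun i => homogeneousComponent_isHomogeneous _ _, ?_⟩
  have h := congrArg (homogeneousComponent (N₀ + e)) hc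
  rw [homogeneousComponent_eq_self (isHomogeneous_X_pow k _), map_sum] at h
  rw [← h]
  exact Finset.sum_congr rfl fun i _ => homogeneousComponent_mul_of_isHomogeneous (he i) (by omega)

/-- A homogeneous polynomial map without nontrivial zeros is finite: the coordinates of a point are
integral over any field that contains the values of the map there. -/
theorem isIntegral_of_aeval_mem [IsAlgClosed K] {F : σ → MvPolynomial σ K} {e : ℕ} (he₀ : 0 < e)
    (hF : ∀ v : σ → K, (∀ i, eval v (F i) = 0) → v = 0) (he : ∀ i, (F i).IsHomogeneous e)
    {M E : Type*} [Field M] [CommRing E] [Algebra K M] [Algebra K E] [Algebra M E]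
    [IsScalarTower K M E] {w : σ → E} {r : σ → M}
    (hw : ∀ i, aeval w (F i) = algebraMap M E (r i)) (k : σ) : IsIntegral M (w k) := by
  classical
  obtain ⟨N, heN, hN⟩ := exists_pow_X_eq_sum hF he
  let S : Submodule M E := Submodule.span M (Set.range fun m : σ → Fin N => ∏ i, w i ^ (m i : ℕ))
  -- Rewriting `wₖ ^ N` as `∑ cᵢ(w) rᵢ` with `cᵢ` of degree `N - e` lowers the total degree by `e >
  -- 0`.
  have hmon : ∀ d : ℕ, ∀ m : σ → ℕ, ∑ i, m i = d → ∏ i, w i ^ m i ∈ S := by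
    intro d
    induction d using Nat.strong_induction_on with
    | _ d ih =>
      intro m hm
      by_cases hlt : ∀ i, m i < N
      · exact Submodule.subset_span ⟨fun i => ⟨m i, hlt i⟩, rfl⟩
      · push Not at hlt
        obtain ⟨k, hk⟩ := hlt
        obtain ⟨c, hc, hck⟩ := hN k
        have hm' : m = (fun i => (Pi.single k N : σ → ℕ) i + Function.update m k (m k - N) i) := by
          ext i
          by_cases hi : i = k
          · subst hi
            simp [hk]
          · simp [hi]
        have hprod : ∏ i, w i ^ m i = w k ^ N * ∏ i, w i ^ Function.update m k (m k - N) i := by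
          conv_lhs => rw [hm']
          simp only [pow_add, Finset.prod_mul_distrib]
          congr 1
          rw [Finset.prod_eq_single k (fun i _ hi => by simp [hi]) (by simp)]
          simp
        have hsum : d = N + ∑ i, Function.update m k (m k - N) i := by
          rw [← hm]
          conv_lhs => rw [hm']
          rw [Finset.sum_add_distrib, Finset.sum_pi_single']
          simp
        have hwk : w k ^ N = ∑ i, aeval w (c i) * algebraMap M E (r i) := by
          have := congrArg (aeval w) hck
          simpa [hw] using this
        rw [hprod, hwk, Finset.sum_mul]
        refine S.sum_mem fun i _ => ?_
        rw [mul_comm (aeval w (c i)), mul_assoc, ← Algebra.smul_def]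
        refine S.smul_mem _ ?_
        rw [aeval_def, eval₂_eq', Finset.sum_mul]
        refine S.sum_mem fun s hs => ?_
        rw [IsScalarTower.algebraMap_apply K M E, mul_assoc, ← Algebra.smul_def,
          ← Finset.prod_mul_distrib]
        simp only [← pow_add]
        refine S.smul_mem _ (ih _ ?_ _ rfl)
        have hs' : ∑ i, s i = N - e := by
          have := (hc i) (mem_support_iff.1 hs)
          rw [Finsupp.weight_apply, Finsupp.sum_fintype _ _ (by simp)] at this
          simpa using this
        rw [Finset.sum_add_distrib, hs']
        omega
  have hle : ∀ p : MvPolynomial σ M, aeval w p ∈ S := fun p => by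
    rw [aeval_def, eval₂_eq']
    refine S.sum_mem fun s _ => ?_
    rw [← Algebra.smul_def]
    exact S.smul_mem _ (hmon _ _ rfl)
  have hfg : (aeval w : MvPolynomial σ M →ₐ[M] E).range.toSubmodule.FG := by
    have : IsNoetherian M S := isNoetherian_span_of_finite M (Set.finite_range _)
    refine Submodule.FG.of_le (S.fg_top.1 (IsNoetherian.noetherian ⊤)) ?_
    rintro _ ⟨p, rfl⟩
    exact hle p
  exact IsIntegral.of_mem_of_fg _ hfg _ ⟨X k, aeval_X _ _⟩

end FiniteMap

/-! ### Derivations of function fields and their constants. -/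

section DerivationExtension

open MvPolynomial

theorem aeval_trivSqZeroExt {K L σ : Type*} [CommRing K] [CommRing L] [Algebra K L] [Fintype σ]
    (v b : σ → L) (g : MvPolynomial σ K) :
    aeval (fun j => TrivSqZeroExt.inl (v j) + TrivSqZeroExt.inr (b j) : σ → TrivSqZeroExt L L) g =
      TrivSqZeroExt.inl (aeval v g) +
        TrivSqZeroExt.inr (∑ j, aeval v (pderiv j g) * b j) := by
  classical
  induction g using MvPolynomial.induction_on with
  | C a => simp [TrivSqZeroExt.algebraMap_eq_inl']
  | add p q hp hq =>
    rw [map_add, hp, hq]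
    ext <;> simp [add_mul, Finset.sum_add_distrib]
  | mul_X p i hp =>
    rw [map_mul, hp, aeval_X]
    ext
    · simp
    · simp only [TrivSqZeroExt.snd_mul, TrivSqZeroExt.snd_add, TrivSqZeroExt.fst_add,
        TrivSqZeroExt.fst_inl, TrivSqZeroExt.snd_inl, TrivSqZeroExt.fst_inr,
        TrivSqZeroExt.snd_inr, add_zero, zero_add, smul_eq_mul, MulOpposite.smul_eq_mul_unop,
        MulOpposite.unop_op, Derivation.leibniz, pderiv_X, map_add, map_mul, aeval_X, add_mul,
        Finset.sum_add_distrib, Finset.sum_mul]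
      congr 1
      · simp [Pi.single_apply, apply_ite]
      · rw [zero_mul, zero_add]
        exact Finset.sum_congr rfl fun j _ => by ring

/-- A derivation is a section of the dual numbers `L[ε] → L`. By `hb` the substitution `v + εb`
kills `ker π`; it extends to fractions because an element of `L[ε]` with nonzero constant term is a
unit. -/
theorem exists_derivation_of_surjective {K A L σ : Type*} [CommRing K] [CommRing A] [IsDomain A]
    [Field L] [Algebra K A] [Algebra K L] [Algebra A L] [IsScalarTower K A L]
    [IsFractionRing A L] [Fintype σ] (π : MvPolynomial σ K →ₐ[K] A)
    (hπ : Function.Surjective π) (b : σ → L)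
    (hb : ∀ g, π g = 0 → ∑ j, algebraMap A L (π (pderiv j g)) * b j = 0) :
    ∃ D : Derivation K L L, ∀ j, D (algebraMap A L (π (X j))) = b j := by
  let v : σ → L := fun j => algebraMap A L (π (X j))
  have hv : ∀ g, aeval v g = algebraMap A L (π g) := fun g => by
    have : aeval v = (IsScalarTower.toAlgHom K A L).comp π := by
      ext j
      simp [v]
    rw [this]
    rfl
  let φ : MvPolynomial σ K →ₐ[K] TrivSqZeroExt L L :=
    aeval (fun j => TrivSqZeroExt.inl (v j) + TrivSqZeroExt.inr (b j))
  have hφ : ∀ g, φ g = _ := aeval_trivSqZeroExt v b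
  have hker : RingHom.ker π ≤ RingHom.ker φ := fun g hg => by
    rw [RingHom.mem_ker] at hg ⊢
    simp [hφ, hv, hg, hb g hg]
  let ψ : A →ₐ[K] TrivSqZeroExt L L := AlgHom.liftOfSurjective π hπ φ hker
  have hψ : ∀ g, ψ (π g) = φ g := AlgHom.liftOfSurjective_apply π hπ φ hker
  have hfst : ∀ a, (ψ a).fst = algebraMap A L a := fun a => by
    obtain ⟨g, rfl⟩ := hπ a
    rw [hψ, hφ, ← hv]
    simp
  have hunit : ∀ a : nonZeroDivisors A, IsUnit (ψ a) := fun a => by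
    rw [TrivSqZeroExt.isUnit_iff_isUnit_fst, hfst]
    exact IsLocalization.map_units L a
  let Ψ : L →ₐ[K] TrivSqZeroExt L L := IsLocalization.liftAlgHom hunit
  have hΨ : ∀ a, Ψ (algebraMap A L a) = ψ a := fun a => IsLocalization.lift_eq hunit a
  have hid : ∀ x, (Ψ x).fst = x := fun x => by
    have : ((TrivSqZeroExt.fstHom K L L).comp Ψ : L →+* L) = RingHom.id L :=
      IsLocalization.ringHom_ext (nonZeroDivisors A) (RingHom.ext fun a => by simp [hΨ, hfst])
    exact RingHom.congr_fun this x
  refine ⟨Derivation.mk' ((TrivSqZeroExt.sndHom L L).restrictScalars K ∘ₗ Ψ.toLinearMap)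
    fun x y => ?_, fun j => ?_⟩
  · simp [hid, mul_comm]
  · simp [hΨ, hψ, φ]

theorem derivation_eq_zero_of_isIntegral {K L : Type*} [Field K] [Field L] [CharZero L]
    [Algebra K L] (D : Derivation K L L) {x : L} (hx : IsIntegral K x) : D x = 0 := by
  have : CharZero K := (algebraMap K L).charZero_iff (algebraMap K L).injective |>.2 inferInstance
  have h := D.map_aeval (minpoly K x) x
  rw [minpoly.aeval, D.map_zero] at h
  refine (mul_eq_zero.1 h.symm).resolve_left ?_
  exact (minpoly.irreducible hx).separable.aeval_derivative_ne_zero (minpoly.aeval K x)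

/-- The field of constants of a derivation. -/
def constants {K L : Type*} [Field K] [Field L] [Algebra K L] (D : Derivation K L L) :
    IntermediateField K L where
  carrier := {x | D x = 0}
  mul_mem' := fun {x y} (hx : D x = 0) (hy : D y = 0) => by
    simp [hx, hy]
  add_mem' := fun {x y} (hx : D x = 0) (hy : D y = 0) => by
    simp [hx, hy]
  algebraMap_mem' := fun r => D.map_algebraMap r
  inv_mem' := fun x (hx : D x = 0) => by
    simp [D.leibniz_inv, hx]

theorem mem_constants {K L : Type*} [Field K] [Field L] [Algebra K L] {D : Derivation K L L}
    {x : L} : x ∈ constants D ↔ D x = 0 :=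
  Iff.rfl

/-- The field of constants is algebraically closed in the whole field. -/
theorem mem_constants_of_isIntegral {K L : Type*} [Field K] [Field L] [CharZero L] [Algebra K L]
    (D : Derivation K L L) {x : L} (hx : IsIntegral (constants D) x) : x ∈ constants D := by
  let D' : Derivation (constants D) L L := Derivation.mk'
    { toFun := D
      map_add' := map_add D
      map_smul' := fun c y => by
        have hc : D (c : L) = 0 := c.2
        simp [Algebra.smul_def, hc] } D.leibniz
  exact derivation_eq_zero_of_isIntegral D' hx

end DerivationExtension

/-! ### Vector fields killed by a finite quadratic map. -/

section KeyLemma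

open MvPolynomial

theorem sum_aeval_pderiv_mul {K L σ : Type*} [CommRing K] [CommRing L] [Algebra K L] [Fintype σ]
    {g : MvPolynomial σ K} {d : ℕ} (hg : g.IsHomogeneous d) (v : σ → L) :
    ∑ j, aeval v (pderiv j g) * v j = d * aeval v g := by
  have h := congrArg (aeval v) hg.sum_X_mul_pderiv
  simpa [mul_comm] using h

theorem aeval_smul_of_isHomogeneous {K L σ : Type*} [CommRing K] [CommRing L] [Algebra K L]
    [Fintype σ] {g : MvPolynomial σ K} {d : ℕ} (hg : g.IsHomogeneous d) (a : L) (v : σ → L) :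
    aeval (a • v) g = a ^ d * aeval v g := by
  simp only [aeval_def, eval₂_eq', Finset.mul_sum]
  refine Finset.sum_congr rfl fun m hm => ?_
  have hd : ∑ i, m i = d := by
    have h := hg (mem_support_iff.1 hm)
    rw [Finsupp.weight_apply, Finsupp.sum_fintype _ _ (by simp)] at h
    simpa using h
  simp only [Pi.smul_apply, smul_eq_mul, mul_pow, Finset.prod_mul_distrib, Finset.prod_pow_eq_pow_sum,
    hd]
  ring

/-- A vector field along which a finite homogeneous quadratic map is constant up to rescaling of
the point vanishes. -/
theorem derivation_add_smul_eq_zero {K L σ : Type*} [Field K] [IsAlgClosed K] [Field L]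
    [CharZero L] [Algebra K L] [Fintype σ] {F : σ → MvPolynomial σ K}
    (hF : ∀ v : σ → K, (∀ i, eval v (F i) = 0) → v = 0) (he : ∀ i, (F i).IsHomogeneous 2)
    (D : Derivation K L L) {v : σ → L} (hv : v ≠ 0) (μ : L)
    (h : ∀ i, ∑ j, aeval v (pderiv j (F i)) * (D (v j) + μ * v j) = 0) (j : σ) :
    D (v j) + μ * v j = 0 := by
  obtain ⟨m, hm⟩ : ∃ m, aeval v (F m) ≠ 0 := by
    by_contra! hall
    exact hv (eq_zero_of_aeval_eq_zero hF hall)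
  obtain ⟨i₀, hi₀⟩ := Function.ne_iff.1 hv
  rw [Pi.zero_apply] at hi₀
  -- Euler's formula in degree 2; every `Fᵢ(v)` scales alike, so their ratios are constants.
  have hD : ∀ i, D (aeval v (F i)) = -(2 * μ) * aeval v (F i) := fun i => by
    have h1 := h i
    have h2 := sum_aeval_pderiv_mul (he i) v
    simp only [mul_add, Finset.sum_add_distrib, mul_left_comm _ μ, ← Finset.mul_sum] at h1
    rw [h2] at h1
    rw [derivation_aeval]
    simp only [smul_eq_mul]
    push_cast at h1
    linear_combination h1
  have hratio : ∀ i, aeval v (F i) / aeval v (F m) ∈ constants D := fun i => by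
    rw [mem_constants, D.leibniz_div, hD i, hD m]
    simp only [smul_eq_mul]
    ring
  -- Dividing `v` by a square root of `Fₘ(v)` turns the values of `F` into these ratios, so
  -- finiteness makes the new coordinates integral over the constants.
  obtain ⟨s, hs⟩ := IsAlgClosed.exists_pow_nat_eq
    (algebraMap L (AlgebraicClosure L) (aeval v (F m))) (n := 2) (by norm_num)
  have hs0 : s ≠ 0 := by
    rintro rfl
    exact hm ((algebraMap L (AlgebraicClosure L)).injective (by simpa using hs.symm))
  let w : σ → AlgebraicClosure L := s⁻¹ • fun j => algebraMap L (AlgebraicClosure L) (v j)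
  have hw : ∀ i, aeval w (F i) = algebraMap (constants D) (AlgebraicClosure L)
      ⟨aeval v (F i) / aeval v (F m), hratio i⟩ := fun i => by
    rw [aeval_smul_of_isHomogeneous (he i), inv_pow, hs,
      IsScalarTower.algebraMap_apply (constants D) L (AlgebraicClosure L)]
    have : aeval (fun j => algebraMap L (AlgebraicClosure L) (v j)) (F i) =
        algebraMap L (AlgebraicClosure L) (aeval v (F i)) := aeval_algebraMap_apply _ _ _
    rw [this, IntermediateField.algebraMap_apply, map_div₀, div_eq_inv_mul]
  have hint : ∀ k, IsIntegral (constants D) (w k) :=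
    isIntegral_of_aeval_mem (by norm_num) hF he hw
  have hconst : ∀ k, D (v k / v i₀) = 0 := fun k => by
    refine mem_constants_of_isIntegral D ?_
    have h1 : IsIntegral (constants D) (algebraMap L (AlgebraicClosure L) (v k / v i₀)) := by
      have h2 : algebraMap L (AlgebraicClosure L) (v k / v i₀) = w k * (w i₀)⁻¹ := by
        have : algebraMap L (AlgebraicClosure L) (v i₀) ≠ 0 := by simpa using hi₀
        simp only [w, Pi.smul_apply, smul_eq_mul, map_div₀]
        field_simp
      rw [h2]
      exact (hint k).mul (hint i₀).inv
    exact (isIntegral_algebraMap_iff (algebraMap L (AlgebraicClosure L)).injective).1 h1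
  have hDv : ∀ k, D (v k) = D (v i₀) / v i₀ * v k := fun k => by
    have h1 := hconst k
    rw [D.leibniz_div] at h1
    simp only [smul_eq_mul] at h1
    field_simp at h1 ⊢
    linear_combination h1
  have hfac : ∀ k, D (v k) + μ * v k = (D (v i₀) / v i₀ + μ) * v k := fun k => by
    rw [hDv k]
    ring
  -- The field is now radial, and Euler's formula gives `(D(v_{i₀}) / v_{i₀} + μ) · 2 Fₘ(v) = 0`.
  have h1 := h m
  simp only [hfac, mul_left_comm _ (D (v i₀) / v i₀ + μ), ← Finset.mul_sum] at h1
  rw [sum_aeval_pderiv_mul (he m) v] at h1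
  have h2 : D (v i₀) / v i₀ + μ = 0 := by simpa [hm] using h1
  rw [hfac, h2, zero_mul]

end KeyLemma

/-! ### The Hessian of a smooth cubic. -/

section Hessian

open MvPolynomial

theorem pderiv_pderiv_comm {K σ : Type*} [CommRing K] (i j : σ) (g : MvPolynomial σ K) :
    pderiv i (pderiv j g) = pderiv j (pderiv i g) := by
  classical
  have h : ⁅(pderiv i : Derivation K (MvPolynomial σ K) (MvPolynomial σ K)),
      (pderiv j : Derivation K (MvPolynomial σ K) (MvPolynomial σ K))⁆ = 0 :=
    derivation_ext fun k => by
      simp only [Derivation.commutator_apply, pderiv_X, Pi.single_apply, Derivation.zero_apply]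
      split_ifs <;> simp
  rw [← sub_eq_zero, ← Derivation.commutator_apply, h, Derivation.zero_apply]

theorem pderiv_det {K σ m : Type*} [CommRing K] [Fintype m] [DecidableEq m] (k : σ)
    (M : Matrix m m (MvPolynomial σ K)) :
    pderiv k M.det = ∑ j, ∑ i, M.adjugate j i * pderiv k (M i j) :=
  derivation_det _ _

variable {K : Type*} [Field K] {n : ℕ} {f : MvPolynomial (Fin (n + 1)) K}

theorem hessianMatrix_apply_comm (f : MvPolynomial (Fin (n + 1)) K) (i j : Fin (n + 1)) :
    hessianMatrix f i j = hessianMatrix f j i := by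
  simp only [hessianMatrix, Matrix.of_apply]
  exact pderiv_pderiv_comm ..

theorem isHomogeneous_hessianMatrix_apply (hf : f.IsHomogeneous 3) (i j : Fin (n + 1)) :
    (hessianMatrix f i j).IsHomogeneous 1 :=
  hf.pderiv.pderiv

theorem isHomogeneous_hessian (hf : f.IsHomogeneous 3) : (hessian f).IsHomogeneous (n + 1) := by
  rw [hessian, Matrix.det_apply]
  refine IsHomogeneous.sum _ _ _ fun σ _ => ?_
  have h : (∏ i, hessianMatrix f (σ i) i).IsHomogeneous (n + 1) := by
    simpa using IsHomogeneous.prod Finset.univ (fun i => hessianMatrix f (σ i) i) (fun _ => 1)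
      fun i _ => isHomogeneous_hessianMatrix_apply hf _ _
  exact (homogeneousSubmodule _ K (n + 1)).toAddSubgroup.zsmul_mem h _

theorem eq_zero_of_isSmoothHypersurface [CharZero K] (hf : f.IsHomogeneous 3)
    (hsmooth : IsSmoothHypersurface f) (v : Fin (n + 1) → K)
    (hv : ∀ i, eval v (pderiv i f) = 0) : v = 0 := by
  by_contra hv0
  have hmem : Projectivization.mk K v hv0 ∈ singularLocus f := by
    rw [mk_mem_singularLocus hf]
    refine ⟨?_, funext hv⟩
    have h := congrArg (eval v) hf.sum_X_mul_pderiv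
    simpa [hv] using h
  rw [hsmooth] at hmem
  exact hmem

variable {L : Type*} [Field L] [Algebra K L]

theorem isSymm_map_hessianMatrix (f : MvPolynomial (Fin (n + 1)) K) (v : Fin (n + 1) → L) :
    ((hessianMatrix f).map (aeval v)).IsSymm :=
  Matrix.IsSymm.ext fun i j => by
    rw [Matrix.map_apply, Matrix.map_apply, hessianMatrix_apply_comm]

theorem aeval_hessian (f : MvPolynomial (Fin (n + 1)) K) (v : Fin (n + 1) → L) :
    aeval v (hessian f) = ((hessianMatrix f).map (aeval v)).det :=
  AlgHom.map_det _ _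

theorem aeval_pderiv_hessian (f : MvPolynomial (Fin (n + 1)) K) (v : Fin (n + 1) → L)
    (k : Fin (n + 1)) :
    aeval v (pderiv k (hessian f)) = ∑ j, ∑ i, ((hessianMatrix f).map (aeval v)).adjugate j i *
      aeval v (pderiv k (hessianMatrix f i j)) := by
  have h : ∀ i j, ((hessianMatrix f).map (aeval v)).adjugate i j =
      aeval v ((hessianMatrix f).adjugate i j) := fun i j => by
    rw [← AlgHom.mapMatrix_apply, ← AlgHom.map_adjugate, AlgHom.mapMatrix_apply, Matrix.map_apply]
  simp only [hessian, pderiv_det, map_sum, map_mul, h]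

theorem aeval_eq_of_isHomogeneous_zero {g : MvPolynomial (Fin (n + 1)) K} (hg : g.IsHomogeneous 0)
    (u v : Fin (n + 1) → L) : aeval u g = aeval v g := by
  have h := fun w : Fin (n + 1) → L => aeval_smul_of_isHomogeneous hg 0 w
  simp only [zero_smul, pow_zero, one_mul] at h
  rw [← h u, ← h v]

/-- Third derivatives of a cubic are constants, so `v` may be replaced by `u`; Euler's formula for
`∂ₖf` and then for its partials gives the factor `2 · 1`. -/
theorem sum_mul_aeval_pderiv_hessianMatrix (hf : f.IsHomogeneous 3) (u v : Fin (n + 1) → L)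
    (k : Fin (n + 1)) :
    ∑ j, ∑ i, u j * u i * aeval v (pderiv k (hessianMatrix f i j)) =
      2 * aeval u (pderiv k f) := by
  have h : ∀ i j, aeval v (pderiv k (hessianMatrix f i j)) =
      aeval u (pderiv i (pderiv j (pderiv k f))) := fun i j => by
    rw [aeval_eq_of_isHomogeneous_zero (isHomogeneous_hessianMatrix_apply hf i j).pderiv v u,
      hessianMatrix, Matrix.of_apply, pderiv_pderiv_comm, pderiv_pderiv_comm k j]
  have h2 := sum_aeval_pderiv_mul (hf.pderiv (i := k)) u
  push_cast at h2
  rw [← h2]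
  refine Finset.sum_congr rfl fun j _ => ?_
  have h1 := sum_aeval_pderiv_mul ((hf.pderiv (i := k)).pderiv (i := j)) u
  norm_num at h1
  rw [← h1, Finset.sum_mul]
  exact Finset.sum_congr rfl fun i _ => by
    rw [h]
    ring

theorem adjugate_hessianMatrix_eq_zero [IsAlgClosed K] [CharZero L] (hf : f.IsHomogeneous 3)
    (hF : ∀ v : Fin (n + 1) → K, (∀ i, eval v (pderiv i f) = 0) → v = 0) {v : Fin (n + 1) → L}
    (h0 : aeval v (hessian f) = 0) (h1 : ∀ k, aeval v (pderiv k (hessian f)) = 0) :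
    ((hessianMatrix f).map (aeval v)).adjugate = 0 := by
  by_contra hadj
  rw [aeval_hessian] at h0
  obtain ⟨u, hu0, γ, hγ, hu⟩ := exists_adjugate_apply_eq (isSymm_map_hessianMatrix f v) h0 hadj
  refine hu0 (eq_zero_of_aeval_eq_zero hF fun k => ?_)
  have h := h1 k
  simp only [aeval_pderiv_hessian, hu, mul_assoc γ, ← Finset.mul_sum,
    sum_mul_aeval_pderiv_hessianMatrix hf] at h
  simpa [hγ] using h

theorem sum_aeval_pderiv_pderiv_mul {v a : Fin (n + 1) → L}
    (ha : ((hessianMatrix f).map (aeval v)).mulVec a = 0) (i : Fin (n + 1)) :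
    ∑ j, aeval v (pderiv j (pderiv i f)) * a j = 0 := by
  have h := congrFun ha i
  simp only [Matrix.mulVec, dotProduct, Matrix.map_apply, hessianMatrix_apply_comm f i] at h
  exact h

theorem hessian_ne_zero [IsAlgClosed K] [CharZero K] (hf : f.IsHomogeneous 3)
    (hF : ∀ v : Fin (n + 1) → K, (∀ i, eval v (pderiv i f) = 0) → v = 0) : hessian f ≠ 0 := by
  intro h0
  let R := MvPolynomial (Fin (n + 1)) K
  let L := FractionRing R
  have : CharZero L := charZero_of_injective_algebraMap (algebraMap K L).injective
  let v : Fin (n + 1) → L := fun j => algebraMap R L (X j)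
  have hdet : ((hessianMatrix f).map (aeval v)).det = 0 := by
    rw [← aeval_hessian, h0, map_zero]
  obtain ⟨a, ha0, ha⟩ := Matrix.exists_mulVec_eq_zero_iff.2 hdet
  -- A polynomial ring has no relations, so any vector `a` defines a derivation.
  obtain ⟨D, hD⟩ := exists_derivation_of_surjective (L := L) (AlgHom.id K R)
    Function.surjective_id a fun g hg => by
      rw [AlgHom.id_apply] at hg
      simp [hg]
  have hDv : ∀ j, D (v j) = a j := hD
  have hv : v ≠ 0 := fun h => by
    have h1 : algebraMap R L (X 0) = 0 := congrFun h 0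
    exact X_ne_zero (R := K) (0 : Fin (n + 1)) ((FaithfulSMul.algebraMap_eq_zero_iff R L).1 h1)
  refine ha0 (funext fun j => ?_)
  have := derivation_add_smul_eq_zero hF (fun i => hf.pderiv) D hv 0
    (fun i => by simpa [hDv] using sum_aeval_pderiv_pderiv_mul ha i) j
  simpa [hDv] using this

theorem pderiv_dehomogenize (i : Fin (n + 1)) (g : MvPolynomial (Fin (n + 1)) K) (j : Fin n) :
    pderiv j (dehomogenize i g) = dehomogenize i (pderiv (i.succAbove j) g) := by
  rw [dehomogenize, derivation_aeval, Fin.sum_univ_succAbove _ i]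
  simp [pderiv_X, Pi.single_apply, dehomogenize]

theorem exists_mem_ne_zero_sum_eq_zero {W : Submodule L (Fin (n + 1) → L)}
    (hW : 2 ≤ finrank L W) (i : Fin (n + 1)) (c y : Fin n → L) :
    ∃ a ∈ W, a ≠ 0 ∧ ∑ j, c j * (a (i.succAbove j) - y j * a i) = 0 := by
  obtain ⟨a, ha, ha0, h⟩ := exists_mem_ne_zero_of_two_le_finrank hW
    (∑ j, c j • (LinearMap.proj (i.succAbove j) - y j • LinearMap.proj i))
  exact ⟨a, ha, ha0, by simpa [LinearMap.sum_apply] using h⟩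

/-- `A` plays the role of `K[y]/(p)`, and `v` is the generic point of `V(p)`, normalized by `vᵢ =
1`. -/
theorem not_mul_self_dvd_dehomogenize_hessian_of_ker [IsAlgClosed K] [CharZero L]
    (hf : f.IsHomogeneous 3)
    (hF : ∀ v : Fin (n + 1) → K, (∀ i, eval v (pderiv i f) = 0) → v = 0) (i : Fin (n + 1))
    {p : MvPolynomial (Fin n) K} {A : Type*} [CommRing A] [IsDomain A] [Algebra K A] [Algebra A L]
    [IsScalarTower K A L] [IsFractionRing A L] (π : MvPolynomial (Fin n) K →ₐ[K] A)
    (hsurj : Function.Surjective π) (hπ : ∀ g, π g = 0 ↔ p ∣ g) :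
    ¬ p * p ∣ dehomogenize i (hessian f) := by
  rintro ⟨q, hq⟩
  obtain ⟨v, hvi, hvs⟩ : ∃ v : Fin (n + 1) → L, v i = 1 ∧
      ∀ j, v (i.succAbove j) = algebraMap A L (π (X j)) :=
    ⟨i.insertNth 1 fun j => algebraMap A L (π (X j)), Fin.insertNth_apply_same ..,
      fun j => Fin.insertNth_apply_succAbove ..⟩
  have hv : ∀ g, aeval v g = algebraMap A L (π (dehomogenize i g)) := fun g => by
    have : aeval v = (IsScalarTower.toAlgHom K A L).comp (π.comp (aeval
        (i.insertNth (1 : MvPolynomial (Fin n) K) X : Fin (n + 1) → MvPolynomial (Fin n) K))) := by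
      ext k
      obtain rfl | ⟨j, rfl⟩ := i.eq_self_or_eq_succAbove k
      · simp [hvi]
      · simp [hvs]
    rw [this]
    rfl
  have h0 : aeval v (hessian f) = 0 := by
    rw [hv, (hπ _).2 ⟨p * q, by rw [hq, mul_assoc]⟩, map_zero]
  have hs : ∀ j, aeval v (pderiv (i.succAbove j) (hessian f)) = 0 := fun j => by
    rw [hv, ← pderiv_dehomogenize, hq, (hπ _).2, map_zero]
    simp only [Derivation.leibniz, smul_eq_mul]
    exact ⟨p * pderiv j q + q * (pderiv j p + pderiv j p), by ring⟩
  -- The chart sees all partials but the `i`-th; Euler's formula supplies that one.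
  have h1 : ∀ k, aeval v (pderiv k (hessian f)) = 0 := by
    rw [Fin.forall_iff_succAbove i]
    refine ⟨?_, hs⟩
    have h := sum_aeval_pderiv_mul (isHomogeneous_hessian hf) v
    rw [Fin.sum_univ_succAbove _ i] at h
    simpa [hs, h0, hvi] using h
  -- Subtracting `aᵢ v` makes the `i`-th coordinate zero, as `vᵢ = 1` requires; tangency to `V(p)`
  -- is then one linear condition on a kernel of dimension at least 2.
  obtain ⟨a, ha, ha0, hb⟩ := exists_mem_ne_zero_sum_eq_zero
    (two_le_finrank_ker_of_adjugate_eq_zero (adjugate_hessianMatrix_eq_zero hf hF h0 h1)) i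
    (fun j => algebraMap A L (π (pderiv j p))) fun j => v (i.succAbove j)
  obtain ⟨D, hD⟩ := exists_derivation_of_surjective (L := L) π
    hsurj (fun j => a (i.succAbove j) - v (i.succAbove j) * a i) fun g hg => by
      obtain ⟨r, rfl⟩ := (hπ g).1 hg
      have hpp : π p = 0 := (hπ p).2 dvd_rfl
      simp only [Derivation.leibniz, smul_eq_mul, map_add, map_mul, hpp, zero_mul,
        zero_add, mul_assoc, ← Finset.mul_sum, hb, mul_zero]
  have hDv : ∀ k, D (v k) + a i * v k = a k := by
    rw [Fin.forall_iff_succAbove i]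
    refine ⟨by simp [hvi], fun j => ?_⟩
    rw [hvs, hD, ← hvs]
    ring
  refine ha0 (funext fun k => ?_)
  have hv0 : v ≠ 0 := fun h => by
    have := congrFun h i
    rw [hvi] at this
    exact one_ne_zero this
  rw [← hDv k]
  exact derivation_add_smul_eq_zero hF (fun i => hf.pderiv) D hv0 (a i)
    (fun l => by simpa only [hDv] using sum_aeval_pderiv_pderiv_mul ha l) k

theorem not_mul_self_dvd_dehomogenize_hessian [IsAlgClosed K] [CharZero K] (hf : f.IsHomogeneous 3)
    (hF : ∀ v : Fin (n + 1) → K, (∀ i, eval v (pderiv i f) = 0) → v = 0) (i : Fin (n + 1))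
    {p : MvPolynomial (Fin n) K} (hp : Irreducible p) : ¬ p * p ∣ dehomogenize i (hessian f) := by
  have hprime : (Ideal.span {p}).IsPrime := (Ideal.span_singleton_prime hp.ne_zero).2 hp.prime
  have : CharZero (FractionRing (MvPolynomial (Fin n) K ⧸ Ideal.span {p})) :=
    charZero_of_injective_algebraMap (algebraMap K _).injective
  exact not_mul_self_dvd_dehomogenize_hessian_of_ker
    (L := FractionRing (MvPolynomial (Fin n) K ⧸ Ideal.span {p})) hf hF i
    (Ideal.Quotient.mkₐ K (Ideal.span {p})) (Ideal.Quotient.mkₐ_surjective K _)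
    fun _ => Ideal.Quotient.eq_zero_iff_mem.trans Ideal.mem_span_singleton

theorem isReducedHypersurface_hessian [IsAlgClosed K] [CharZero K] (hf : f.IsHomogeneous 3)
    (hF : ∀ v : Fin (n + 1) → K, (∀ i, eval v (pderiv i f) = 0) → v = 0) :
    IsReducedHypersurface (hessian f) := by
  intro i
  rw [← Ideal.isRadical_iff_quotient_reduced, ← isRadical_iff_span_singleton,
    isRadical_iff_squarefree_or_zero, or_iff_not_imp_right]
  -- A zero equation needs no argument here: the quotient is then a polynomial ring.
  intro h0
  rw [squarefree_iff_no_irreducibles h0]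
  exact fun p hp => not_mul_self_dvd_dehomogenize_hessian hf hF i hp

theorem singularLocus_hessian [IsAlgClosed K] [CharZero K] (hn : 1 ≤ n) (hf : f.IsHomogeneous 3)
    (hF : ∀ v : Fin (n + 1) → K, (∀ i, eval v (pderiv i f) = 0) → v = 0) :
    singularLocus (hessian f) = degeneracyLocus f (n - 1) := by
  ext P
  -- Rank–nullity in dimension `n + 1`; `1 ≤ n` keeps the truncated subtraction honest.
  have hrank : (hessianMatrixAt f P.rep).rank ≤ n - 1 ↔
      2 ≤ finrank K (LinearMap.ker (hessianMatrixAt f P.rep).mulVecLin) := by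
    have h := LinearMap.finrank_range_add_finrank_ker (hessianMatrixAt f P.rep).mulVecLin
    rw [finrank_fin_fun] at h
    rw [Matrix.rank]
    omega
  have hmap : hessianMatrixAt f P.rep = (hessianMatrix f).map (aeval P.rep) := by
    rfl
  have heval : ∀ g, eval P.rep g = aeval P.rep g := fun _ => rfl
  rw [singularLocus, degeneracyLocus, Set.mem_ofPred_eq, Set.mem_ofPred_eq, hrank, heval]
  constructor
  · rintro ⟨h0, h1⟩
    rw [hmap]
    exact two_le_finrank_ker_of_adjugate_eq_zero
      (adjugate_hessianMatrix_eq_zero hf hF h0 fun k => congrFun h1 k)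
  · intro h
    have hadj := adjugate_eq_zero_of_two_le_finrank_ker h
    rw [hmap] at h hadj
    constructor
    · obtain ⟨u, hu, hu0, -⟩ := exists_mem_ne_zero_of_two_le_finrank h 0
      rw [aeval_hessian]
      exact Matrix.exists_mulVec_eq_zero_iff.1 ⟨u, hu0, hu⟩
    · ext k
      rw [gradientAt, heval, aeval_pderiv_hessian, hadj]
      simp

end Hessian

end

end CubicHessian

theorem theorem2p1 {K : Type*} [Field K] [IsAlgClosed K] [CharZero K] {n : ℕ} (hn : 2 ≤ n)
    (f : MvPolynomial (Fin (n + 1)) K) (hf : f.IsHomogeneous 3)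
    (hsmooth : CubicHessian.IsSmoothHypersurface f) :
    CubicHessian.hessian f ≠ 0 ∧
      CubicHessian.IsReducedHypersurface (CubicHessian.hessian f) ∧
      CubicHessian.singularLocus (CubicHessian.hessian f) =
        CubicHessian.degeneracyLocus f (n - 1) := by
  have hF := CubicHessian.eq_zero_of_isSmoothHypersurface hf hsmooth
  exact ⟨CubicHessian.hessian_ne_zero hf hF, CubicHessian.isReducedHypersurface_hessian hf hF,
    CubicHessian.singularLocus_hessian (by omega) hf hF⟩
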